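/- Let $0<q<1$ and $\alpha>0$, and write $(x;q^2)_n=\prod_{i=0}^{n-1}(1-xq^{2i})$. **Functions and distributions.** Let $\mathrm{Pol}(\mathbb C)_q$ be the unital algebra generated by $z,z^*$ with the relation $z^*z=q^2zz^*+1-q^2$, and let $T$ be its representation in the space $H$ with basis $v_j$ ($j\in\mathbb Z_+$) given by $T(z)v_j=v_{j+1}$, $T(z^*)v_j=(1-q^{2j})v_{j-1}$ (zero for $j=0$). Let $H'$ be the space of formal series $\sum_j c_jv_j$. The space of distributions $D(U)_q'$ is identified by $T$ with $\mathrm{Hom}_{\mathbb C}(H,H')$, with the topology of convergence of each matrix element; the space of finite functions $D(U)_q$ is identified with the operators in $H$ with finitely many nonzero matrix elements in the basis $(v_j)$. Let $(1-zz^*)^{\lambda}$ be defined by $T((1-zz^*)^\lambda)v_n=q^{2n\lambda}v_n$, and for $f\in D(U)_q'$, $\psi\in D(U)_q$ put $\int f\psi\,d\nu=(1-q^2)\,\mathrm{tr}\,T\big(f\psi(1-zz^*)^{-1}\big)$. **Toeplitz-Bergman operators.** Let $L^2_{q,\alpha}\subset D(U)_q'$ be the completion of $D(U)_q$ in the scalar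 product $(f,g)_{q,\alpha}=\frac{1-q^{4\alpha}}{1-q^2}\int g^*f(1-zz^*)^{2\alpha+1}d\nu$, where $g^*$ is the adjoint for the scalar product $(v_j,v_k)=\delta_{jk}(q^2;q^2)_j$ in $H$. Explicitly, $L^2_{q,\alpha}$ consists of the $f$ with matrix elements $f_{mk}$ such that $(1-q^{4\alpha})\sum_{m,k}q^{4\alpha k}\frac{(q^2;q^2)_m}{(q^2;q^2)_k}|f_{mk}|^2<\infty$. Let $P_{q,\alpha}$ be the orthogonal projection of $L^2_{q,\alpha}$ onto the closure of $\mathbb C[z]$. For $\psi\in D(U)_q$, $\psi=z$ or $\psi=z^*$, the Toeplitz-Bergman operator $\widehat\psi:\mathbb C[z]\to\mathbb C[z]$ is $\widehat\psi:p\mapsto P_{q,\alpha}(\psi p)$. Write $\widehat z$, $\widehat z^*$ for those with symbols $z$, $z^*$. **Covariant symbols.** Let $\overline F_{q,\alpha}=\mathrm{Hom}_{\mathbb C}(\mathbb C[z],\mathbb C[[z]])$ with the topology of pointwise convergence ($\mathbb C[[z]]$ carrying coefficientwise convergence), and let $\mathrm{tr}_q(A)=\sum_k a_{kk}q^{-2k}$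 for $A:z^j\mapsto\sum_m a_{mj}z^m$ vanishing on all but finitely many $z^j$. A distribution $f\in D(U)_q'$ is a covariant symbol of $A\in\overline F_{q,\alpha}$ if $$\int f\psi\,d\nu=\frac{1-q^2}{1-q^{4\alpha}}\,\mathrm{tr}_q(A\widehat\psi)\qquad\text{for all }\psi\in D(U)_q .$$ **Proposition.** The operators $\widehat z$, $\widehat z^*$ and $\widehat\psi$ ($\psi\in D(U)_q$) exist as operators in $\mathbb C[z]$. 1. For every family of complex numbers $(a_{jk})_{j,k\in\mathbb Z_+}$, the series $\sum_{j,k}a_{jk}\widehat z^{\,j}\widehat z^{*k}$ converges in $\overline F_{q,\alpha}$, the series $\sum_{j,k}a_{jk}z^jz^{*k}$ converges in $D(U)_q'$, and the sum of the second is a covariant symbol of the sum of the first. 2. Every $A\in\overline F_{q,\alpha}$ has exactly one covariant symbol, and the resulting map $\overline F_{q,\alpha}\to D(U)_q'$ is one-to-one: every distribution is the covariant symbol of exactly one operator. -/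

import Mathlib

open Polynomial

noncomputable section

namespace QDisc

/-! ### The algebra of polynomials on the quantum disc and its representation -/

/-- The defining relation `z* z = q² z z* + 1 - q²`; `true` stands for the generator `z`,
`false` for the generator `z*`. -/
inductive PolRel (q : ℝ) : FreeAlgebra ℂ Bool → FreeAlgebra ℂ Bool → Prop
  | comm : PolRel q
      (FreeAlgebra.ι ℂ false * FreeAlgebra.ι ℂ true)
      (((q ^ 2 : ℝ) : ℂ) • (FreeAlgebra.ι ℂ true * FreeAlgebra.ι ℂ false)
        + ((1 - q ^ 2 : ℝ) : ℂ) • 1)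

/-- `Pol(ℂ)_q`: the unital algebra with generators `z`, `z*` and the relation above. -/
abbrev Pol (q : ℝ) : Type := RingQuot (PolRel q)

/-- The generator `z`. -/
def z (q : ℝ) : Pol q := RingQuot.mkAlgHom ℂ (PolRel q) (FreeAlgebra.ι ℂ true)

/-- The generator `z*`. -/
def zs (q : ℝ) : Pol q := RingQuot.mkAlgHom ℂ (PolRel q) (FreeAlgebra.ι ℂ false)

/-- The vector space `H` with basis `v_j`, `j ∈ ℤ₊`. -/
abbrev H : Type := ℕ →₀ ℂ

/-- The basis vector `v_j`. -/
def v (j : ℕ) : H := Finsupp.single j 1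

/-- The space `H'` of formal series `∑ c_j v_j` (all antilinear functionals on `H`). -/
abbrev H' : Type := ℕ → ℂ

/-- The operator `T(z) : v_j ↦ v_{j+1}`. -/
def Tz : Module.End ℂ H := Finsupp.linearCombination ℂ (fun j => v (j + 1))

/-- The operator `T(z*) : v_j ↦ (1 - q^{2j}) v_{j-1}` (zero for `j = 0`). -/
def Tzs (q : ℝ) : Module.End ℂ H :=
  Finsupp.linearCombination ℂ (fun j => ((1 - q ^ (2 * j) : ℝ) : ℂ) • v (j - 1))

lemma Tz_v (j : ℕ) : Tz (v j) = v (j + 1) := by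
  simp [Tz, v]

lemma Tzs_v (q : ℝ) (j : ℕ) : Tzs q (v j) = ((1 - q ^ (2 * j) : ℝ) : ℂ) • v (j - 1) := by
  simp [Tzs, v]

lemma Tzs_mul_Tz (q : ℝ) :
    Tzs q * Tz = ((q ^ 2 : ℝ) : ℂ) • (Tz * Tzs q) + ((1 - q ^ 2 : ℝ) : ℂ) • 1 := by
  refine Finsupp.lhom_ext' fun j => LinearMap.ext_ring ?_
  change Tzs q (Tz (v j)) = ((q ^ 2 : ℝ) : ℂ) • (Tz (Tzs q (v j))) + ((1 - q ^ 2 : ℝ) : ℂ) • v j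
  rw [Tz_v, Tzs_v, Tzs_v, map_smul, Tz_v]
  rcases j with _ | j
  · simp
  · simp only [Nat.add_sub_cancel, smul_smul, ← add_smul]
    congr 1
    push_cast
    ring

/-- The representation `T` of `Pol(ℂ)_q` in `H`. -/
def T (q : ℝ) : Pol q →ₐ[ℂ] Module.End ℂ H :=
  RingQuot.liftAlgHom ℂ
    ⟨FreeAlgebra.lift ℂ (fun b : Bool => if b then Tz else Tzs q), by
      intro x y h
      cases h
      simpa using Tzs_mul_Tz q⟩

lemma T_z (q : ℝ) : T q (z q) = Tz := by
  simp [T, z]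

lemma T_zs (q : ℝ) : T q (zs q) = Tzs q := by
  simp [T, zs]

/-! ### Finite functions, distributions, the invariant integral -/

/-- The space `D(U)_q'` of distributions: `T` identifies it with `Hom(H, H')`. -/
abbrev Dist : Type := H →ₗ[ℂ] H'

/-- The topology of `D(U)_q'`: convergence of every matrix element in the basis `v_j`. -/
instance : TopologicalSpace Dist :=
  TopologicalSpace.induced (fun (f : Dist) (k m : ℕ) => f (v k) m) inferInstance

/-- The embedding of the operators in `H` into the distributions, through `H ⊂ H'`. -/
def toDist : Module.End ℂ H →ₗ[ℂ] Dist where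
  toFun A := (Finsupp.lcoeFun : H →ₗ[ℂ] H') ∘ₗ A
  map_add' _ _ := LinearMap.comp_add _ _ _
  map_smul' _ _ := LinearMap.comp_smul _ _ _

/-- The finite functions `D(U)_q`: `T` identifies them with the operators in `H` that have
finitely many nonzero matrix elements in the basis `v_j`. -/
def IsFiniteFunction (f : Module.End ℂ H) : Prop :=
  {p : ℕ × ℕ | f (v p.2) p.1 ≠ 0}.Finite

/-- The function `(1 - z z*)^s`, whose image under `T` is `v_n ↦ q^{2ns} v_n`. -/
def oneSubPow (q s : ℝ) : Module.End ℂ H :=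
  Finsupp.linearCombination ℂ (fun n => ((q ^ (2 * (n : ℝ) * s) : ℝ) : ℂ) • v n)

/-- The invariant integral `∫ f dν = (1 - q²) tr T(f (1 - z z*)⁻¹)`, for distributions `f` with
finitely many nonzero columns (such as `f = g ψ`, with `g` any distribution and `ψ` finite). -/
def integral (q : ℝ) (f : Dist) : ℂ :=
  ((1 - q ^ 2 : ℝ) : ℂ) * ∑ᶠ k : ℕ, f (oneSubPow q (-1) (v k)) k

/-! ### The spaces `L²_{q,α}`, `H²_{q,α}` and Toeplitz-Bergman operators -/

/-- `(q²; q²)_n = ‖v_n‖²`, for the scalar product in `H` that makes `T` a `*`-representation. -/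
def normSqV (q : ℝ) (n : ℕ) : ℝ := ∏ i ∈ Finset.range n, (1 - q ^ (2 * (i + 1)))

/-- The scalar product in `H`, antilinear in the second argument. -/
def scalarH (q : ℝ) (x y : H) : ℂ :=
  x.sum fun n c => c * (starRingEnd ℂ) (y n) * (normSqV q n : ℂ)

lemma scalarH_v_right (q : ℝ) (x : H) (k : ℕ) :
    scalarH q x (v k) = x k * (normSqV q k : ℂ) := by
  classical
  unfold scalarH v
  rw [Finsupp.sum, Finset.sum_eq_single k]
  · simp
  · intro n _ hn
    simp [Ne.symm hn]
  · intro hk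
    simp [Finsupp.notMem_support_iff.mp hk]

lemma scalarH_v_left (q : ℝ) (y : H) (k : ℕ) :
    scalarH q (v k) y = (starRingEnd ℂ) (y k) * (normSqV q k : ℂ) := by
  simp [scalarH, v, Finsupp.sum_single_index]

lemma normSqV_pos {q : ℝ} (hq0 : 0 < q) (hq1 : q < 1) (n : ℕ) : 0 < normSqV q n :=
  Finset.prod_pos fun i _ => sub_pos.mpr (pow_lt_one₀ hq0.le hq1 (by omega))

/-- On basis vectors, `T(z*)` is the adjoint of `T(z)`. -/
lemma scalarH_Tz (q : ℝ) (j k : ℕ) :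
    scalarH q (Tz (v j)) (v k) = scalarH q (v j) (Tzs q (v k)) := by
  rw [scalarH_v_right, scalarH_v_left, Tz_v, Tzs_v]
  rcases k with _ | k
  · simp [v]
  · by_cases h : j = k
    · subst h
      simp [v, normSqV, Finset.prod_range_succ, mul_comm]
    · simp [v, h, Ne.symm h]

/-- The square of the norm in `L²_{q,α}` of the matrix unit `v_k ↦ v_m`. -/
def weight (q α : ℝ) (m k : ℕ) : ℝ :=
  (1 - q ^ (4 * α)) * q ^ (4 * α * (k : ℝ)) * (normSqV q m / normSqV q k)

/-- The Hilbert space `L²_{q,α}`, written in the orthonormal basis of normalized matrix units. It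
becomes a space of distributions, depending on `α`, through `L2.toDist`. -/
abbrev L2 : Type := lp (fun _ : ℕ × ℕ => ℂ) 2

/-- The embedding of `L²_{q,α}` in `D(U)_q'`. -/
def L2.toDist (q α : ℝ) : L2 →ₗ[ℂ] Dist where
  toFun x := Finsupp.linearCombination ℂ
    (fun k m => (((Real.sqrt (weight q α m k))⁻¹ : ℝ) : ℂ) * x (m, k))
  map_add' x y := by
    refine Finsupp.lhom_ext' fun j => LinearMap.ext_ring ?_
    ext m
    simp [mul_add]
  map_smul' c x := by
    refine Finsupp.lhom_ext' fun j => LinearMap.ext_ring ?_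
    ext m
    simp [mul_left_comm]

lemma weight_pos {q α : ℝ} (hq0 : 0 < q) (hq1 : q < 1) (hα : 0 < α) (m k : ℕ) :
    0 < weight q α m k :=
  mul_pos (mul_pos (sub_pos.mpr (Real.rpow_lt_one hq0.le hq1 (by positivity)))
    (Real.rpow_pos_of_pos hq0 _)) (div_pos (normSqV_pos hq0 hq1 m) (normSqV_pos hq0 hq1 k))

lemma L2.toDist_v (q α : ℝ) (x : L2) (m k : ℕ) :
    L2.toDist q α x (v k) m = (((Real.sqrt (weight q α m k))⁻¹ : ℝ) : ℂ) * x (m, k) := by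
  simp [L2.toDist, v]

lemma L2.apply_eq {q α : ℝ} (hq0 : 0 < q) (hq1 : q < 1) (hα : 0 < α) (x : L2) (m k : ℕ) :
    x (m, k) = ((Real.sqrt (weight q α m k) : ℝ) : ℂ) * L2.toDist q α x (v k) m := by
  have h : ((Real.sqrt (weight q α m k) : ℝ) : ℂ) ≠ 0 :=
    Complex.ofReal_ne_zero.mpr (Real.sqrt_pos.mpr (weight_pos hq0 hq1 hα m k)).ne'
  rw [L2.toDist_v, Complex.ofReal_inv, mul_inv_cancel_left₀ h]

lemma L2.toDist_injective {q α : ℝ} (hq0 : 0 < q) (hq1 : q < 1) (hα : 0 < α) :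
    Function.Injective (L2.toDist q α) := by
  intro x y h
  ext ⟨m, k⟩
  rw [L2.apply_eq hq0 hq1 hα, L2.apply_eq hq0 hq1 hα, h]

lemma oneSubPow_v (q s : ℝ) (n : ℕ) :
    oneSubPow q s (v n) = ((q ^ (2 * (n : ℝ) * s) : ℝ) : ℂ) • v n := by
  simp [oneSubPow, v]

/-- The scalar product of `L²_{q,α}` is, on finite functions `f` and `g`, the integral
`(f, g) = ∫ g* f dν_α = (1 - q^{4α}) / (1 - q²) · ∫ g* f (1 - z z*)^{2α+1} dν`. -/
lemma L2.inner_eq {q α : ℝ} (hq0 : 0 < q) (hq1 : q < 1) (hα : 0 < α)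
    (f g gs : Module.End ℂ H) (hf : IsFiniteFunction f)
    (hgs : ∀ u w : H, scalarH q (gs u) w = scalarH q u (g w))
    (x y : L2) (hx : L2.toDist q α x = QDisc.toDist f) (hy : L2.toDist q α y = QDisc.toDist g) :
    inner ℂ y x = (((1 - q ^ (4 * α)) / (1 - q ^ 2) : ℝ) : ℂ) *
      integral q (QDisc.toDist (gs * f * oneSubPow q (2 * α + 1))) := by
  classical
  have hq2 : (1 - q ^ 2 : ℝ) ≠ 0 := (sub_pos.mpr (pow_lt_one₀ hq0.le hq1 two_ne_zero)).ne'
  -- the diagonal matrix elements of `g* f`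
  have hdiag (k : ℕ) : gs (f (v k)) k = ∑ m ∈ (f (v k)).support,
      f (v k) m * (starRingEnd ℂ) (g (v k) m) * ((normSqV q m / normSqV q k : ℝ) : ℂ) := by
    have h := hgs (f (v k)) (v k)
    rw [scalarH_v_right] at h
    have hk : (normSqV q k : ℂ) ≠ 0 := Complex.ofReal_ne_zero.mpr (normSqV_pos hq0 hq1 k).ne'
    rw [eq_div_of_mul_eq hk h, scalarH, Finsupp.sum, Finset.sum_div]
    refine Finset.sum_congr rfl fun m _ => ?_
    push_cast
    ring
  set S : Finset (ℕ × ℕ) := hf.toFinset with hS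
  have hmem (m k : ℕ) : (m, k) ∈ S ↔ f (v k) m ≠ 0 := Set.Finite.mem_toFinset hf
  have hxe (m k : ℕ) : x (m, k) = ((Real.sqrt (weight q α m k) : ℝ) : ℂ) * f (v k) m := by
    rw [L2.apply_eq hq0 hq1 hα, hx]; rfl
  have hye (m k : ℕ) : y (m, k) = ((Real.sqrt (weight q α m k) : ℝ) : ℂ) * g (v k) m := by
    rw [L2.apply_eq hq0 hq1 hα, hy]; rfl
  have hL : inner ℂ y x = ∑ p ∈ S,
      (weight q α p.1 p.2 : ℂ) * (f (v p.2) p.1 * (starRingEnd ℂ) (g (v p.2) p.1)) := by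
    rw [lp.inner_eq_tsum, tsum_eq_sum (s := S)]
    · refine Finset.sum_congr rfl fun p _ => ?_
      obtain ⟨m, k⟩ := p
      rw [hxe, hye]
      have hw : ((Real.sqrt (weight q α m k) : ℝ) : ℂ) * ((Real.sqrt (weight q α m k) : ℝ) : ℂ)
          = (weight q α m k : ℂ) := by
        rw [← Complex.ofReal_mul, Real.mul_self_sqrt (weight_pos hq0 hq1 hα m k).le]
      simp only [RCLike.inner_apply, map_mul, Complex.conj_ofReal]
      rw [← hw]
      ring
    · rintro ⟨m, k⟩ hp
      have : f (v k) m = 0 := by simpa [hmem] using hp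
      simp [hxe, this]
  have hR (k : ℕ) : QDisc.toDist (gs * f * oneSubPow q (2 * α + 1)) (oneSubPow q (-1) (v k)) k
      = ((q ^ (4 * α * (k : ℝ)) : ℝ) : ℂ) * gs (f (v k)) k := by
    rw [oneSubPow_v]
    simp only [map_smul]
    change _ * (gs (f (oneSubPow q (2 * α + 1) (v k)))) k = _
    rw [oneSubPow_v]
    simp only [map_smul, Finsupp.smul_apply, smul_eq_mul, ← mul_assoc, ← Complex.ofReal_mul]
    rw [← Real.rpow_add hq0]
    congr 4
    ring
  have hsupp : (Function.support fun k : ℕ => ((q ^ (4 * α * (k : ℝ)) : ℝ) : ℂ) * gs (f (v k)) k)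
      ⊆ (S.image Prod.snd : Finset ℕ) := by
    intro k hk
    by_contra hc
    apply hk
    have : f (v k) = 0 := by
      ext m
      by_contra hm
      exact hc (by
        simp only [Finset.coe_image, Set.mem_image, Finset.mem_coe]
        exact ⟨(m, k), (hmem m k).mpr hm, rfl⟩)
    simp [this]
  rw [hL, integral, finsum_congr hR, finsum_eq_sum_of_support_subset _ hsupp, ← mul_assoc,
    ← Complex.ofReal_mul, div_mul_cancel₀ _ hq2, Finset.mul_sum,
    ← Finset.sum_fiberwise_of_maps_to (g := Prod.snd) (t := S.image Prod.snd)
      (fun p hp => Finset.mem_image_of_mem _ hp)]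
  refine Finset.sum_congr rfl fun k _ => ?_
  rw [hdiag, Finset.mul_sum, Finset.mul_sum]
  refine Finset.sum_bij' (fun p _ => p.1) (fun m _ => (m, k)) ?_ ?_ ?_ ?_ ?_
  · rintro ⟨m, k'⟩ hp
    obtain ⟨h1, rfl⟩ := Finset.mem_filter.mp hp
    simpa [hmem] using h1
  · intro m hm
    refine Finset.mem_filter.mpr ⟨(hmem m k).mpr (Finsupp.mem_support_iff.mp hm), rfl⟩
  · rintro ⟨m, k'⟩ hp
    obtain ⟨h1, rfl⟩ := Finset.mem_filter.mp hp
    rfl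
  · intro m hm
    rfl
  · rintro ⟨m, k'⟩ hp
    obtain ⟨h1, rfl⟩ := Finset.mem_filter.mp hp
    simp only [weight]
    push_cast
    ring

/-- The operator `T(ψ(z))`, for a polynomial `ψ`. -/
def polyOp (q : ℝ) : ℂ[X] →ₐ[ℂ] Module.End ℂ H := (T q).comp (aeval (z q))

/-- `H²_{q,α}`: the closure in `L²_{q,α}` of the polynomials in `z`. -/
def H2 (q α : ℝ) : Submodule ℂ L2 :=
  (Submodule.comap (L2.toDist q α)
    (LinearMap.range (toDist ∘ₗ (polyOp q).toLinearMap))).topologicalClosure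

instance (q α : ℝ) : CompleteSpace (H2 q α) :=
  (Submodule.isClosed_topologicalClosure _).completeSpace_coe

/-- The orthogonal projection `P_{q,α}` of `L²_{q,α}` onto `H²_{q,α}`. -/
def proj (q α : ℝ) : L2 →L[ℂ] L2 := (H2 q α).starProjection

/-- `F` is the Toeplitz-Bergman operator `ψ ↦ P_{q,α}(f ψ)` in `ℂ[z]` with symbol `f`, where `f`
is a finite function or a polynomial in `z`, `z*` (given by the operator `T(f)` in `H`). -/
def IsToeplitzBergman (q α : ℝ) (f : Module.End ℂ H) (F : Module.End ℂ ℂ[X]) : Prop :=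
  ∀ ψ : ℂ[X], ∃ x : L2,
    L2.toDist q α x = toDist (f * polyOp q ψ) ∧
    L2.toDist q α (proj q α x) = toDist (polyOp q (F ψ))

lemma polyOp_v_zero (q : ℝ) (p : ℂ[X]) (m : ℕ) : polyOp q p (v 0) m = p.coeff m := by
  have hz (n : ℕ) : (Tz ^ n) (v 0) = v n := by
    induction n with
    | zero => simp
    | succ n ih => rw [pow_succ', Module.End.mul_apply, ih, Tz_v]
  induction p using Polynomial.induction_on' with
  | add p r hp hr => simp [map_add, hp, hr]
  | monomial n a =>
    have : polyOp q (monomial n a) = a • Tz ^ n := by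
      simp [polyOp, aeval_monomial, T_z, Algebra.algebraMap_eq_smul_one]
    rw [this, LinearMap.smul_apply, hz]
    simp [v, Finsupp.single_apply, coeff_monomial]

/-- There is at most one Toeplitz-Bergman operator with a given symbol. -/
lemma IsToeplitzBergman.unique {q α : ℝ} (hq0 : 0 < q) (hq1 : q < 1) (hα : 0 < α)
    {f : Module.End ℂ H} {F G : Module.End ℂ ℂ[X]}
    (hF : IsToeplitzBergman q α f F) (hG : IsToeplitzBergman q α f G) : F = G := by
  refine LinearMap.ext fun ψ => ?_
  obtain ⟨x, hx, hx'⟩ := hF ψ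
  obtain ⟨y, hy, hy'⟩ := hG ψ
  obtain rfl : x = y := L2.toDist_injective hq0 hq1 hα (hx.trans hy.symm)
  ext m
  have h := congrFun (congrArg (fun D : Dist => D (v 0)) (hx'.symm.trans hy')) m
  rw [← polyOp_v_zero q, ← polyOp_v_zero q]
  exact h

/-! ### The space of operators and the covariant symbol -/

/-- The space of all linear operators from `ℂ[z]_{q,α}` to its completion `ℂ[[z]]_{q,α}`. -/
abbrev Fbar : Type := ℂ[X] →ₗ[ℂ] PowerSeries ℂ

/-- The topology of pointwise convergence, with coefficientwise convergence in `ℂ[[z]]`. -/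
instance : TopologicalSpace Fbar :=
  TopologicalSpace.induced
    (fun (A : Fbar) (ψ : ℂ[X]) (m : ℕ) => PowerSeries.coeff m (A ψ)) inferInstance

/-- The embedding of the operators in `ℂ[z]` into `Fbar`, through `ℂ[z] ⊂ ℂ[[z]]`. -/
def toFbar : Module.End ℂ ℂ[X] →ₗ[ℂ] Fbar where
  toFun A := (Polynomial.coeToPowerSeries.algHom ℂ).toLinearMap ∘ₗ A
  map_add' _ _ := LinearMap.comp_add _ _ _
  map_smul' _ _ := LinearMap.comp_smul _ _ _

/-- The functional `tr_q(A) = ∑ a_{kk} q^{-2k}`, where `A : z^j ↦ ∑ a_{mj} z^m`, for operators `A`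
that vanish on all but finitely many `z^j`. -/
def trq (q : ℝ) (A : Fbar) : ℂ :=
  ∑ᶠ k : ℕ, PowerSeries.coeff k (A (X ^ k)) * (((q ^ (2 * k))⁻¹ : ℝ) : ℂ)

/-- `f` is the covariant symbol of `A`: for every finite function `ψ`,
`∫ f ψ dν = (1 - q²) / (1 - q^{4α}) · tr_q(A ψ^)`,
where `ψ^` is the Toeplitz-Bergman operator with symbol `ψ`. -/
def IsCovariantSymbol (q α : ℝ) (A : Fbar) (f : Dist) : Prop :=
  ∀ ψ : Module.End ℂ H, IsFiniteFunction ψ →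
    ∃ Ψ : Module.End ℂ ℂ[X], IsToeplitzBergman q α ψ Ψ ∧
      integral q (f ∘ₗ ψ) =
        (((1 - q ^ 2) / (1 - q ^ (4 * α)) : ℝ) : ℂ) * trq q (A ∘ₗ Ψ)

end QDisc

end

noncomputable section

namespace QDisc

/-! ### Convolution along diagonals -/

/-! Write t = q^{4α}. Divide the matrix element of f at v_a by ‖v_a‖² = (q²;q²)_a, and that of A at
z^a by ‖z^a‖² = (q²;q²)_a / (tq²;q²)_a. In these normalizations everything becomes multiplication by
a power series along the diagonals of infinite matrices (`diagConv`).

Testing the defining identity on matrix units, which span the finite functions, shows that f is a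
covariant symbol of A exactly when the matrix of f is the matrix of A convolved with h(x) = ∑
(tq²)^s x^s / (q²;q²)_s (`isCovariantSymbol_iff`). Since h has nonzero constant term, it is
invertible as a power series, so the symbol map is bijective: this is part 2.

For part 1, a normally ordered monomial sends z^i, or v_i, to a multiple of one basis vector. The
sums of the two series therefore have as normalized matrices the convolutions of (a_jk) with ∑ x^j /
‖z^j‖² and with ∑ x^n / ‖v_n‖². Each entry is a finite sum, which gives convergence for arbitrary
coefficients. It remains to see that h carries the first series to the second
(`symbolSeries_mul_zNormSeries`), a case of the q-binomial theorem: the three series are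
1/(tq²x;q²)_∞, (tq²x;q²)_∞/(x;q²)_∞ and 1/(x;q²)_∞. -/

/-- The convolution `(b, a) ↦ ∑ κ_s M (b - s) (a - s)` of a sequence with an infinite matrix. -/
def diagConv (κ : PowerSeries ℂ) (M : ℕ → ℕ → ℂ) (b a : ℕ) : ℂ :=
  ∑ s ∈ Finset.range (min b a + 1), PowerSeries.coeff s κ * M (b - s) (a - s)

/-- The diagonal of an infinite matrix that starts at `(e, d)`, as a power series. -/
def diag (M : ℕ → ℕ → ℂ) (e d : ℕ) : PowerSeries ℂ :=
  PowerSeries.mk fun i => M (e + i) (d + i)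

/-- With truncated subtraction, (b - a, a - b) is the border point of the diagonal through (b, a),
and `min b a` is the position of (b, a) on it. -/
lemma diagConv_eq_coeff (κ : PowerSeries ℂ) (M : ℕ → ℕ → ℂ) (b a : ℕ) :
    diagConv κ M b a = PowerSeries.coeff (min b a) (κ * diag M (b - a) (a - b)) := by
  rw [PowerSeries.coeff_mul, Finset.Nat.sum_antidiagonal_eq_sum_range_succ_mk, diagConv]
  refine Finset.sum_congr rfl fun s hs => ?_
  have := Finset.mem_range.mp hs
  simp only [diag, PowerSeries.coeff_mk]
  congr 2 <;> omega

lemma diag_diagConv (κ : PowerSeries ℂ) (M : ℕ → ℕ → ℂ) (b a : ℕ) :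
    diag (diagConv κ M) (b - a) (a - b) = κ * diag M (b - a) (a - b) := by
  ext n
  rw [diag, PowerSeries.coeff_mk, diagConv_eq_coeff]
  congr 3 <;> omega

/-- Power series thus act on infinite matrices, and an invertible series acts bijectively. -/
lemma diagConv_mul (κ μ : PowerSeries ℂ) (M : ℕ → ℕ → ℂ) :
    diagConv (κ * μ) M = diagConv κ (diagConv μ M) := by
  ext b a
  rw [diagConv_eq_coeff, diagConv_eq_coeff, diag_diagConv, mul_assoc]

lemma diagConv_one (M : ℕ → ℕ → ℂ) : diagConv 1 M = M := by
  ext b a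
  rw [diagConv_eq_coeff, one_mul, diag, PowerSeries.coeff_mk]
  congr 1 <;> omega

/-- The summand has the shape of an entry of a normally ordered monomial. Only the finitely many
points (m - u, i - u) contribute, so no growth condition on `M` is needed. -/
lemma hasSum_diagConv (κ : PowerSeries ℂ) (M : ℕ → ℕ → ℂ) (m i : ℕ) :
    HasSum (fun p : ℕ × ℕ => M p.1 p.2 *
      (if p.2 ≤ i ∧ m + p.2 = i + p.1 then PowerSeries.coeff (i - p.2) κ else 0))
      (diagConv κ M m i) := by
  classical
  have hinj : Set.InjOn (fun u => (m - u, i - u)) (Finset.range (min m i + 1) : Set ℕ) := by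
    intro u hu w hw h
    simp only [Finset.coe_range, Set.mem_Iio] at hu hw
    simp only [Prod.mk.injEq] at h
    omega
  have h := hasSum_sum_of_ne_finset_zero
    (s := (Finset.range (min m i + 1)).image fun u => (m - u, i - u))
    (f := fun p : ℕ × ℕ => M p.1 p.2 *
      (if p.2 ≤ i ∧ m + p.2 = i + p.1 then PowerSeries.coeff (i - p.2) κ else 0))
    (L := SummationFilter.unconditional _) ?_
  · rw [Finset.sum_image hinj] at h
    convert h using 1
    refine Finset.sum_congr rfl fun s hs => ?_
    have := Finset.mem_range.mp hs
    rw [if_pos ⟨by omega, by omega⟩, mul_comm]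
    congr 3
    omega
  · rintro ⟨j, k⟩ hp
    rw [if_neg, mul_zero]
    rintro ⟨h1, h2⟩
    refine hp (Finset.mem_image.mpr ⟨i - k, Finset.mem_range.mpr ?_, ?_⟩)
    · simp only at h1 h2; omega
    · simp only at h1 h2 ⊢
      ext <;> simp only <;> omega

/-! ### The norms of the powers of `z` -/

lemma normSqV_succ (q : ℝ) (n : ℕ) : normSqV q (n + 1) = normSqV q n * (1 - q ^ (2 * (n + 1))) :=
  Finset.prod_range_succ _ _

lemma one_sub_pow_pos {q : ℝ} (hq0 : 0 < q) (hq1 : q < 1) (n : ℕ) : 0 < 1 - q ^ (2 * (n + 1)) :=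
  sub_pos.mpr (pow_lt_one₀ hq0.le hq1 (by omega))

lemma normSqV_antitone {q : ℝ} (hq0 : 0 < q) (hq1 : q < 1) : Antitone (normSqV q) := by
  refine antitone_nat_of_succ_le fun n => ?_
  rw [normSqV_succ]
  exact mul_le_of_le_one_right (normSqV_pos hq0 hq1 n).le (sub_le_self _ (by positivity))

lemma rpow_mem {q α : ℝ} (hq0 : 0 < q) (hq1 : q < 1) (hα : 0 < α) :
    0 < q ^ (4 * α) ∧ q ^ (4 * α) < 1 :=
  ⟨Real.rpow_pos_of_pos hq0 _, Real.rpow_lt_one hq0.le hq1 (by positivity)⟩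

lemma weight_eq {q α : ℝ} (hq0 : 0 < q) (m k : ℕ) :
    weight q α m k = (1 - q ^ (4 * α)) * (q ^ (4 * α)) ^ k * (normSqV q m / normSqV q k) := by
  rw [weight, Real.rpow_mul_natCast hq0.le]

lemma weight_succ_left (q α : ℝ) (m k : ℕ) :
    weight q α (m + 1) k = weight q α m k * (1 - q ^ (2 * (m + 1))) := by
  rw [weight, weight, normSqV_succ]
  ring

lemma weight_succ_right {q α : ℝ} (hq0 : 0 < q) (hq1 : q < 1) (m k : ℕ) :
    weight q α m (k + 1) * (1 - q ^ (2 * (k + 1))) = q ^ (4 * α) * weight q α m k := by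
  rw [weight_eq hq0, weight_eq hq0, normSqV_succ]
  have := (one_sub_pow_pos hq0 hq1 k).ne'
  have := (normSqV_pos hq0 hq1 k).ne'
  field_simp
  ring

lemma weight_le {q α : ℝ} (hq0 : 0 < q) (hq1 : q < 1) (hα : 0 < α) {m k : ℕ} (h : k ≤ m) :
    weight q α m k ≤ (q ^ (4 * α)) ^ k := by
  obtain ⟨h0, h1⟩ := rpow_mem hq0 hq1 hα
  rw [weight_eq hq0]
  have h2 : normSqV q m / normSqV q k ≤ 1 :=
    (div_le_one (normSqV_pos hq0 hq1 k)).mpr (normSqV_antitone hq0 hq1 h)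
  have h3 : (1 - q ^ (4 * α)) * (q ^ (4 * α)) ^ k ≤ (q ^ (4 * α)) ^ k :=
    mul_le_of_le_one_left (by positivity) (by linarith)
  refine (mul_le_of_le_one_right ?_ h2).trans h3
  exact mul_nonneg (by linarith) (by positivity)

/-- The square of the norm of `z^j` in `L²_{q,α}`. -/
def zNormSq (q α : ℝ) (j : ℕ) : ℝ :=
  ∏ i ∈ Finset.range j, (1 - q ^ (2 * (i + 1))) / (1 - q ^ (4 * α) * q ^ (2 * (i + 1)))

lemma zNormSq_succ (q α : ℝ) (j : ℕ) : zNormSq q α (j + 1) =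
    zNormSq q α j * ((1 - q ^ (2 * (j + 1))) / (1 - q ^ (4 * α) * q ^ (2 * (j + 1)))) :=
  Finset.prod_range_succ _ _

lemma one_sub_rpow_mul_pow_pos {q α : ℝ} (hq0 : 0 < q) (hq1 : q < 1) (hα : 0 < α) (n : ℕ) :
    0 < 1 - q ^ (4 * α) * q ^ (2 * (n + 1)) := by
  obtain ⟨h0, h1⟩ := rpow_mem hq0 hq1 hα
  exact sub_pos.mpr (mul_lt_one_of_nonneg_of_lt_one_left h0.le h1
    (pow_le_one₀ hq0.le hq1.le))

lemma zNormSq_pos {q α : ℝ} (hq0 : 0 < q) (hq1 : q < 1) (hα : 0 < α) (j : ℕ) :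
    0 < zNormSq q α j :=
  Finset.prod_pos fun i _ =>
    div_pos (one_sub_pow_pos hq0 hq1 i) (one_sub_rpow_mul_pow_pos hq0 hq1 hα i)

lemma hasSum_of_eq {ι E : Type*} [AddCommMonoid E] [TopologicalSpace E] {f g : ι → E} {a : E}
    (h : ∀ i, f i = g i) (hg : HasSum g a) : HasSum f a := by
  rwa [funext h]

/-- The sums S_j = ‖z^j‖² satisfy a linear recursion obtained from the two shift rules for the
weight: raising m gives S_{j+1} from S_j, and raising k expresses the correction through S_{j+1}
itself. -/
lemma hasSum_weight {q α : ℝ} (hq0 : 0 < q) (hq1 : q < 1) (hα : 0 < α) (j : ℕ) :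
    HasSum (fun k => weight q α (k + j) k) (zNormSq q α j) := by
  obtain ⟨h0, h1⟩ := rpow_mem hq0 hq1 hα
  have hs (j : ℕ) : Summable fun k => weight q α (k + j) k :=
    Summable.of_nonneg_of_le (fun k => (weight_pos hq0 hq1 hα _ _).le)
      (fun k => weight_le hq0 hq1 hα (by omega)) (summable_geometric_of_lt_one h0.le h1)
  induction j with
  | zero =>
    have h := (hasSum_geometric_of_lt_one h0.le h1).mul_left (1 - q ^ (4 * α))
    rw [mul_inv_cancel₀ (by linarith)] at h
    refine hasSum_of_eq (fun k => ?_) h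
    rw [weight_eq hq0, add_zero, div_self (normSqV_pos hq0 hq1 k).ne', mul_one]
  | succ j ih =>
    convert (hs (j + 1)).hasSum using 1
    set S := ∑' k, weight q α (k + (j + 1)) k with hS
    have hS' : HasSum (fun k => weight q α (k + (j + 1)) k) S := (hs (j + 1)).hasSum
    -- The term k = 0 vanishes; shifting k by one and applying `weight_succ_right` turns the rest
    -- into q^{4α} times the series for S.
    have hR : HasSum (fun k => (1 - q ^ (2 * k)) * weight q α (k + j) k) (q ^ (4 * α) * S) := by
      rw [← hasSum_nat_add_iff' 1]
      simp only [Finset.range_one, Finset.sum_singleton, mul_zero, pow_zero, sub_self, zero_mul,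
        sub_zero]
      refine hasSum_of_eq (fun k => ?_) (hS'.mul_left (q ^ (4 * α)))
      rw [mul_comm, weight_succ_right hq0 hq1]
      congr 2
      omega
    have hT := (ih.sub ((ih.sub hR).mul_left (q ^ (2 * (j + 1)))))
    -- Uses 1 - q^{2(k+j+1)} = 1 - q^{2(j+1)} (1 - (1 - q^{2k})).
    have hE : S = zNormSq q α j - q ^ (2 * (j + 1)) * (zNormSq q α j - q ^ (4 * α) * S) := by
      refine hS'.unique ?_
      refine hasSum_of_eq (fun k => ?_) hT
      rw [← add_assoc, weight_succ_left]
      ring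
    have := (one_sub_rpow_mul_pow_pos hq0 hq1 hα j).ne'
    rw [zNormSq_succ, ← mul_div_assoc, div_eq_iff this]
    linear_combination -hE

/-! ### Three power series -/

/-- The series with coefficients `(q^{4α+2})^s / (q²; q²)_s`. -/
def symbolSeries (q α : ℝ) : PowerSeries ℂ :=
  PowerSeries.mk fun s => (((q ^ (4 * α) * q ^ 2) ^ s / normSqV q s : ℝ) : ℂ)

/-- The series with coefficients `1 / ‖z^j‖²`. -/
def zNormSeries (q α : ℝ) : PowerSeries ℂ :=
  PowerSeries.mk fun j => (((zNormSq q α j)⁻¹ : ℝ) : ℂ)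

/-- The series with coefficients `1 / (q²; q²)_n`. -/
def vNormSeries (q : ℝ) : PowerSeries ℂ :=
  PowerSeries.mk fun n => (((normSqV q n)⁻¹ : ℝ) : ℂ)

/-- The q-binomial identity in coefficients. Both factors satisfy first-order recursions, from which
the sum inherits the recursion of 1/(q²;q²)_n. -/
lemma sum_antidiagonal_symbol {q α : ℝ} (hq0 : 0 < q) (hq1 : q < 1) (hα : 0 < α) (n : ℕ) :
    ∑ p ∈ Finset.HasAntidiagonal.antidiagonal n, (q ^ (4 * α) * q ^ 2) ^ p.1 / normSqV q p.1 *
      (zNormSq q α p.2)⁻¹ = (normSqV q n)⁻¹ := by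
  induction n with
  | zero => simp [zNormSq, normSqV]
  | succ n ih =>
    have hn := (one_sub_pow_pos hq0 hq1 n).ne'
    have hN := (normSqV_pos hq0 hq1 n).ne'
    set h : ℕ → ℝ := fun s => (q ^ (4 * α) * q ^ 2) ^ s / normSqV q s with hh
    set e : ℕ → ℝ := fun u => (zNormSq q α u)⁻¹ with he
    have h1 (s : ℕ) : (1 - q ^ (2 * (s + 1))) * h (s + 1) = q ^ (4 * α) * q ^ 2 * h s := by
      have := (one_sub_pow_pos hq0 hq1 s).ne'
      have := (normSqV_pos hq0 hq1 s).ne'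
      simp only [hh, normSqV_succ]
      field_simp
      ring
    have e1 (u : ℕ) : (1 - q ^ (2 * (u + 1))) * e (u + 1)
        = (1 - q ^ (4 * α) * q ^ (2 * (u + 1))) * e u := by
      have := (one_sub_pow_pos hq0 hq1 u).ne'
      have := (zNormSq_pos hq0 hq1 hα u).ne'
      have := (one_sub_rpow_mul_pow_pos hq0 hq1 hα u).ne'
      simp only [he, zNormSq_succ]
      field_simp
    change ∑ p ∈ Finset.HasAntidiagonal.antidiagonal n, h p.1 * e p.2 = _ at ih
    change ∑ p ∈ Finset.HasAntidiagonal.antidiagonal (n + 1), h p.1 * e p.2 = _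
    have key : (1 - q ^ (2 * (n + 1))) * ∑ p ∈ Finset.HasAntidiagonal.antidiagonal (n + 1), h p.1 * e p.2
        = ∑ p ∈ Finset.HasAntidiagonal.antidiagonal n, h p.1 * e p.2 := by
      -- For s + u = n + 1, the factor 1 - q^{2(n+1)} equals (1 - q^{2u}) + q^{2u}(1 - q^{2s}). Each
      -- part lowers one index, and the terms with q^{4α} then cancel.
      have split : (1 - q ^ (2 * (n + 1))) * ∑ p ∈ Finset.HasAntidiagonal.antidiagonal (n + 1), h p.1 * e p.2
          = ∑ p ∈ Finset.HasAntidiagonal.antidiagonal (n + 1), h p.1 * ((1 - q ^ (2 * p.2)) * e p.2)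
          + ∑ p ∈ Finset.HasAntidiagonal.antidiagonal (n + 1),
              q ^ (2 * p.2) * ((1 - q ^ (2 * p.1)) * h p.1) * e p.2 := by
        rw [Finset.mul_sum, ← Finset.sum_add_distrib]
        refine Finset.sum_congr rfl fun p hp => ?_
        rw [← Finset.HasAntidiagonal.mem_antidiagonal.mp hp, mul_add, pow_add]
        ring
      rw [split, Finset.Nat.sum_antidiagonal_succ', Finset.Nat.sum_antidiagonal_succ]
      simp only [mul_zero, pow_zero, sub_self, zero_mul, zero_add, e1, h1]
      rw [← Finset.sum_add_distrib]
      refine Finset.sum_congr rfl fun p _ => ?_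
      rw [mul_add 2, pow_add]
      ring
    rw [normSqV_succ, mul_inv, ← ih, ← key]
    field_simp

lemma symbolSeries_mul_zNormSeries {q α : ℝ} (hq0 : 0 < q) (hq1 : q < 1) (hα : 0 < α) :
    symbolSeries q α * zNormSeries q α = vNormSeries q := by
  ext n
  rw [PowerSeries.coeff_mul]
  simp only [symbolSeries, zNormSeries, vNormSeries, PowerSeries.coeff_mk]
  rw [← sum_antidiagonal_symbol hq0 hq1 hα]
  push_cast
  rfl

lemma constantCoeff_symbolSeries (q α : ℝ) :
    PowerSeries.constantCoeff (symbolSeries q α) ≠ 0 := by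
  rw [← PowerSeries.coeff_zero_eq_constantCoeff_apply]
  simp [symbolSeries, normSqV]

/-! ### The projection onto `H²_{q,α}` -/

lemma polyOp_X_pow (q : ℝ) (i : ℕ) : polyOp q (X ^ i) = Tz ^ i := by
  simp [polyOp, T_z]

lemma Tz_pow_v (i k : ℕ) : (Tz ^ i) (v k) = v (k + i) := by
  induction i with
  | zero => simp
  | succ i ih => rw [pow_succ', Module.End.mul_apply, ih, Tz_v, add_assoc]

lemma v_apply (j m : ℕ) : v j m = if m = j then 1 else 0 := by
  simp [v, Finsupp.single_apply, eq_comm]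

lemma dist_ext {f g : Dist} (h : ∀ k m, f (v k) m = g (v k) m) : f = g := by
  refine Finsupp.lhom_ext' fun k => LinearMap.ext_ring ?_
  ext m
  exact h k m

/-- The vector of `L²_{q,α}` that is the matrix unit `v_b ↦ v_a`. -/
def unitVec (q α : ℝ) (a b : ℕ) : L2 :=
  lp.single 2 (a, b) ((Real.sqrt (weight q α a b) : ℝ) : ℂ)

section

variable {q α : ℝ}

/-- The support lies on one diagonal, so square-summability is that of a sequence in k, dominated by
a geometric series. -/
lemma memlp_of_shift (hq0 : 0 < q) (hq1 : q < 1) (hα : 0 < α) {e i : ℕ} {F : ℕ × ℕ → ℂ}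
    (h0 : ∀ m k, m + e ≠ k + i → F (m, k) = 0)
    (h : ∀ m k, m + e = k + i → ‖F (m, k)‖ ^ 2 ≤ (q ^ (4 * α)) ^ k) : Memℓp F 2 := by
  obtain ⟨t0, t1⟩ := rpow_mem hq0 hq1 hα
  rw [memℓp_gen_iff (by norm_num)]
  have hinj : Function.Injective fun k : ℕ => (k + i - e, k) := fun k l hkl => (Prod.ext_iff.mp hkl).2
  rw [← hinj.summable_iff]
  · refine Summable.of_nonneg_of_le (fun k => Real.rpow_nonneg (norm_nonneg _) _) (fun k => ?_)
      (summable_geometric_of_lt_one t0.le t1)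
    simp only [Function.comp_apply, ENNReal.toReal_ofNat, Real.rpow_ofNat]
    -- If k + i < e, the truncated difference is 0 and the point is off the diagonal.
    by_cases hk : k + i - e + e = k + i
    · exact h _ _ hk
    · rw [h0 _ _ hk]
      simp only [norm_zero, ne_eq, OfNat.ofNat_ne_zero, not_false_eq_true, zero_pow]
      positivity
  · rintro ⟨m, k⟩ hmk
    rw [h0 m k]
    · simp
    · intro hc
      exact hmk ⟨k, Prod.ext (by simp only; omega) rfl⟩

/-- The power `z^j` as a vector of `L²_{q,α}`. -/
def zVec (hq0 : 0 < q) (hq1 : q < 1) (hα : 0 < α) (j : ℕ) : L2 :=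
  ⟨fun p => if p.1 = p.2 + j then ((Real.sqrt (weight q α p.1 p.2) : ℝ) : ℂ) else 0,
    memlp_of_shift hq0 hq1 hα (e := 0) (i := j)
      (fun m k h => if_neg h)
      (fun m k h => by
        rw [if_pos (by simpa using h), Complex.norm_real, Real.norm_eq_abs, sq_abs,
          Real.sq_sqrt (weight_pos hq0 hq1 hα _ _).le]
        exact weight_le hq0 hq1 hα (by omega))⟩

lemma zVec_apply (hq0 : 0 < q) (hq1 : q < 1) (hα : 0 < α) (j m k : ℕ) :
    zVec hq0 hq1 hα j (m, k)
      = if m = k + j then ((Real.sqrt (weight q α m k) : ℝ) : ℂ) else 0 := rfl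

lemma sqrt_weight_ne_zero (hq0 : 0 < q) (hq1 : q < 1) (hα : 0 < α) (m k : ℕ) :
    ((Real.sqrt (weight q α m k) : ℝ) : ℂ) ≠ 0 :=
  Complex.ofReal_ne_zero.mpr (Real.sqrt_pos.mpr (weight_pos hq0 hq1 hα m k)).ne'

lemma sqrt_weight_mul_self (hq0 : 0 < q) (hq1 : q < 1) (hα : 0 < α) (m k : ℕ) :
    ((Real.sqrt (weight q α m k) : ℝ) : ℂ) * ((Real.sqrt (weight q α m k) : ℝ) : ℂ)
      = (weight q α m k : ℂ) := by
  rw [← Complex.ofReal_mul, Real.mul_self_sqrt (weight_pos hq0 hq1 hα m k).le]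

lemma toDist_zVec (hq0 : 0 < q) (hq1 : q < 1) (hα : 0 < α) (j : ℕ) :
    L2.toDist q α (zVec hq0 hq1 hα j) = toDist (polyOp q (X ^ j)) := by
  refine dist_ext fun k m => ?_
  rw [L2.toDist_v, zVec_apply]
  change _ = (polyOp q (X ^ j) (v k)) m
  rw [polyOp_X_pow, Tz_pow_v, v_apply]
  split_ifs
  · rw [Complex.ofReal_inv, inv_mul_cancel₀ (sqrt_weight_ne_zero hq0 hq1 hα m k)]
  · rw [mul_zero]

lemma inner_zVec (hq0 : 0 < q) (hq1 : q < 1) (hα : 0 < α) (j : ℕ) (x : L2) :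
    inner ℂ (zVec hq0 hq1 hα j) x
      = ∑' k, ((Real.sqrt (weight q α (k + j) k) : ℝ) : ℂ) * x (k + j, k) := by
  rw [lp.inner_eq_tsum]
  have hinj : Function.Injective fun k : ℕ => (k + j, k) := fun k l hkl => (Prod.ext_iff.mp hkl).2
  rw [← hinj.tsum_eq]
  · refine tsum_congr fun k => ?_
    rw [zVec_apply, if_pos rfl, RCLike.inner_apply, Complex.conj_ofReal, mul_comm]
  · rintro ⟨m, k⟩ hmk
    by_contra hc
    refine hmk ?_
    change inner ℂ (zVec hq0 hq1 hα j (m, k)) (x (m, k)) = 0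
    rw [zVec_apply, if_neg, inner_zero_left]
    rintro rfl
    exact hc ⟨k, rfl⟩

lemma inner_zVec_zVec (hq0 : 0 < q) (hq1 : q < 1) (hα : 0 < α) (j i : ℕ) :
    inner ℂ (zVec hq0 hq1 hα j) (zVec hq0 hq1 hα i)
      = if j = i then (zNormSq q α i : ℂ) else 0 := by
  rw [inner_zVec]
  simp only [zVec_apply, add_right_inj]
  split_ifs with h
  · subst h
    rw [← (hasSum_weight hq0 hq1 hα j).tsum_eq, Complex.ofReal_tsum]
    exact tsum_congr fun k => sqrt_weight_mul_self hq0 hq1 hα _ _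
  · simp

lemma inner_zVec_unitVec (hq0 : 0 < q) (hq1 : q < 1) (hα : 0 < α) (j a b : ℕ) :
    inner ℂ (zVec hq0 hq1 hα j) (unitVec q α a b)
      = if a = b + j then (weight q α a b : ℂ) else 0 := by
  rw [unitVec, lp.inner_single_right, zVec_apply, RCLike.inner_apply]
  split_ifs
  · rw [Complex.conj_ofReal, sqrt_weight_mul_self hq0 hq1 hα]
  · simp

lemma toDist_unitVec (hq0 : 0 < q) (hq1 : q < 1) (hα : 0 < α) (a b m k : ℕ) :
    L2.toDist q α (unitVec q α a b) (v k) m = if k = b ∧ m = a then 1 else 0 := by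
  rw [L2.toDist_v, unitVec]
  by_cases h : (m, k) = (a, b)
  · obtain ⟨rfl, rfl⟩ := Prod.ext_iff.mp h
    rw [lp.single_apply_self, if_pos ⟨rfl, rfl⟩, Complex.ofReal_inv,
      inv_mul_cancel₀ (sqrt_weight_ne_zero hq0 hq1 hα _ _)]
  · rw [lp.single_apply_ne _ _ _ h, mul_zero, if_neg]
    rintro ⟨rfl, rfl⟩
    exact h rfl

/-- A polynomial in `z` as a vector of `L²_{q,α}`. -/
def polyVec (hq0 : 0 < q) (hq1 : q < 1) (hα : 0 < α) : ℂ[X] →ₗ[ℂ] L2 :=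
  Polynomial.lsum fun j => LinearMap.toSpanSingleton ℂ L2 (zVec hq0 hq1 hα j)

lemma polyVec_eq_sum (hq0 : 0 < q) (hq1 : q < 1) (hα : 0 < α) (p : ℂ[X]) :
    polyVec hq0 hq1 hα p = ∑ j ∈ p.support, p.coeff j • zVec hq0 hq1 hα j := by
  simp [polyVec, Polynomial.lsum_apply, Polynomial.sum_def]

lemma toDist_polyVec (hq0 : 0 < q) (hq1 : q < 1) (hα : 0 < α) (p : ℂ[X]) :
    L2.toDist q α (polyVec hq0 hq1 hα p) = toDist (polyOp q p) := by
  conv_rhs => rw [p.as_sum_support_C_mul_X_pow]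
  simp only [polyVec_eq_sum, map_sum, map_smul, toDist_zVec, ← smul_eq_C_mul]

lemma inner_zVec_polyVec (hq0 : 0 < q) (hq1 : q < 1) (hα : 0 < α) (j : ℕ) (p : ℂ[X]) :
    inner ℂ (zVec hq0 hq1 hα j) (polyVec hq0 hq1 hα p) = p.coeff j * (zNormSq q α j : ℂ) := by
  rw [polyVec_eq_sum, inner_sum]
  simp only [inner_smul_right, inner_zVec_zVec]
  rw [Finset.sum_eq_single j]
  · simp
  · intro i _ hi
    rw [if_neg hi.symm, mul_zero]
  · intro hj
    rw [notMem_support_iff.mp hj, zero_mul]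

/-- A closed span has the same orthogonal complement as the span, so scalar products with the z^j
determine the projection. -/
lemma proj_eq_polyVec (hq0 : 0 < q) (hq1 : q < 1) (hα : 0 < α) {x : L2} {p : ℂ[X]}
    (h : ∀ j, inner ℂ (zVec hq0 hq1 hα j) x = p.coeff j * (zNormSq q α j : ℂ)) :
    proj q α x = polyVec hq0 hq1 hα p := by
  refine Submodule.eq_starProjection_of_mem_of_inner_eq_zero
    (Submodule.le_topologicalClosure _ ?_) ?_
  · exact ⟨p, (toDist_polyVec hq0 hq1 hα p).symm⟩
  · have hmem : x - polyVec hq0 hq1 hα p ∈ (H2 q α)ᗮ := by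
      rw [H2, Submodule.orthogonal_closure]
      rintro y ⟨r, hr⟩
      obtain rfl : polyVec hq0 hq1 hα r = y :=
        L2.toDist_injective hq0 hq1 hα ((toDist_polyVec hq0 hq1 hα r).trans hr)
      rw [polyVec_eq_sum, sum_inner]
      refine Finset.sum_eq_zero fun j _ => ?_
      rw [inner_smul_left, inner_sub_right, h, inner_zVec_polyVec, sub_self, mul_zero]
    intro w hw
    exact Submodule.inner_left_of_mem_orthogonal hw hmem

/-! ### Toeplitz-Bergman operators -/

lemma isToeplitzBergman_of_basis (hq0 : 0 < q) (hq1 : q < 1) (hα : 0 < α)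
    {f : Module.End ℂ H} {F : Module.End ℂ ℂ[X]}
    (h : ∀ i, ∃ x : L2, L2.toDist q α x = toDist (f * Tz ^ i) ∧
      ∀ j, inner ℂ (zVec hq0 hq1 hα j) x = (F (X ^ i)).coeff j * (zNormSq q α j : ℂ)) :
    IsToeplitzBergman q α f F := by
  intro ψ
  induction ψ using Polynomial.induction_on' with
  | add p r hp hr =>
    obtain ⟨x, hx, hx'⟩ := hp
    obtain ⟨y, hy, hy'⟩ := hr
    exact ⟨x + y, by simp only [map_add, mul_add, hx, hy], by simp only [map_add, hx', hy']⟩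
  | monomial i c =>
    obtain ⟨x, hx, hx'⟩ := h i
    rw [← C_mul_X_pow_eq_monomial, ← smul_eq_C_mul]
    refine ⟨c • x, ?_, ?_⟩
    · rw [map_smul, map_smul, mul_smul_comm, map_smul, hx, polyOp_X_pow]
    · rw [map_smul, map_smul, map_smul, map_smul, map_smul, proj_eq_polyVec hq0 hq1 hα hx',
        toDist_polyVec]

lemma IsToeplitzBergman.add {f g : Module.End ℂ H} {F G : Module.End ℂ ℂ[X]}
    (hF : IsToeplitzBergman q α f F) (hG : IsToeplitzBergman q α g G) :
    IsToeplitzBergman q α (f + g) (F + G) := by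
  intro ψ
  obtain ⟨x, hx, hx'⟩ := hF ψ
  obtain ⟨y, hy, hy'⟩ := hG ψ
  exact ⟨x + y, by simp only [map_add, add_mul, hx, hy],
    by simp only [map_add, hx', hy', LinearMap.add_apply]⟩

lemma IsToeplitzBergman.smul {f : Module.End ℂ H} {F : Module.End ℂ ℂ[X]}
    (hF : IsToeplitzBergman q α f F) (c : ℂ) : IsToeplitzBergman q α (c • f) (c • F) := by
  intro ψ
  obtain ⟨x, hx, hx'⟩ := hF ψ
  exact ⟨c • x, by simp only [map_smul, smul_mul_assoc, hx],
    by simp only [map_smul, hx', LinearMap.smul_apply]⟩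

lemma IsToeplitzBergman.zero : IsToeplitzBergman q α 0 0 :=
  fun ψ => ⟨0, by simp, by simp⟩

end

/-- The linear map on polynomials with prescribed values `X^i ↦ g i`. -/
def ofBasis {M : Type*} [AddCommMonoid M] [Module ℂ M] (g : ℕ → M) : ℂ[X] →ₗ[ℂ] M :=
  Polynomial.lsum fun i => LinearMap.toSpanSingleton ℂ M (g i)

lemma ofBasis_X_pow {M : Type*} [AddCommMonoid M] [Module ℂ M] (g : ℕ → M) (i : ℕ) :
    ofBasis g (X ^ i) = g i := by
  simp [ofBasis, Polynomial.lsum_apply, X_pow_eq_monomial, sum_monomial_index]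

/-- The Toeplitz-Bergman operator with symbol `z`. -/
def zHat : Module.End ℂ ℂ[X] := LinearMap.mulLeft ℂ X

/-- The Toeplitz-Bergman operator with symbol `z*`. -/
def zsHat (q α : ℝ) : Module.End ℂ ℂ[X] :=
  ofBasis fun i => if i = 0 then 0 else
    C ((zNormSq q α i / zNormSq q α (i - 1) : ℝ) : ℂ) * X ^ (i - 1)

/-- The matrix unit `v_b ↦ v_a`. -/
def unitOp (a b : ℕ) : Module.End ℂ H :=
  Finsupp.linearCombination ℂ fun k => if k = b then v a else 0

lemma unitOp_v (a b k : ℕ) : unitOp a b (v k) = if k = b then v a else 0 := by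
  simp [unitOp, v]

/-- The Toeplitz-Bergman operator with symbol `unitOp a b`. -/
def unitHat (q α : ℝ) (a b : ℕ) : Module.End ℂ ℂ[X] :=
  ofBasis fun i => if i ≤ b ∧ b ≤ a + i then
    C ((weight q α a (b - i) / zNormSq q α (a + i - b) : ℝ) : ℂ) * X ^ (a + i - b) else 0

lemma isToeplitzBergman_zHat {q α : ℝ} (hq0 : 0 < q) (hq1 : q < 1) (hα : 0 < α) :
    IsToeplitzBergman q α (T q (z q)) zHat := by
  refine isToeplitzBergman_of_basis hq0 hq1 hα fun i => ⟨zVec hq0 hq1 hα (i + 1), ?_, fun j => ?_⟩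
  · rw [toDist_zVec, polyOp_X_pow, T_z, pow_succ']
  · rw [inner_zVec_zVec, zHat, LinearMap.mulLeft_apply, ← pow_succ', coeff_X_pow]
    split_ifs with h
    · rw [h, one_mul]
    · rw [zero_mul]

/-- The coefficient 1 - q^{2(m+1)} of T(z*) raises the weight from (m, k) to (m + 1, k). Hence the
scalar product of z* z^{j+1} with z^j is ‖z^{j+1}‖². -/
lemma isToeplitzBergman_zsHat {q α : ℝ} (hq0 : 0 < q) (hq1 : q < 1) (hα : 0 < α) :
    IsToeplitzBergman q α (T q (zs q)) (zsHat q α) := by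
  refine isToeplitzBergman_of_basis hq0 hq1 hα fun i => ?_
  have hw (m k : ℕ) := (weight_pos hq0 hq1 hα m k).le
  have hmem : Memℓp (fun p : ℕ × ℕ => if p.1 + 1 = p.2 + i then
      ((Real.sqrt (weight q α p.1 p.2) * (1 - q ^ (2 * (p.1 + 1))) : ℝ) : ℂ) else 0) 2 := by
    refine memlp_of_shift hq0 hq1 hα (e := 1) (i := i) (fun m k h => if_neg h) fun m k h => ?_
    have h1 := one_sub_pow_pos hq0 hq1 m
    have h2 : 1 - q ^ (2 * (m + 1)) ≤ 1 := sub_le_self _ (by positivity)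
    -- One factor 1 - q^{2(m+1)} is absorbed into the weight. This matters for i = 0, where k = m +
    -- 1 exceeds m, but `weight_le` applies at (m + 1, k).
    rw [if_pos (by simpa using h), Complex.norm_real, Real.norm_eq_abs, sq_abs, mul_pow,
      Real.sq_sqrt (hw _ _), sq, ← mul_assoc, ← weight_succ_left]
    exact (mul_le_of_le_one_right (hw _ _) h2).trans (weight_le hq0 hq1 hα (by simp only; omega))
  set x : L2 := ⟨_, hmem⟩ with hx
  have hxa (m k : ℕ) : x (m, k) = if m + 1 = k + i then
      ((Real.sqrt (weight q α m k) * (1 - q ^ (2 * (m + 1))) : ℝ) : ℂ) else 0 := rfl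
  refine ⟨x, dist_ext fun k m => ?_, fun j => ?_⟩
  · rw [L2.toDist_v, hxa]
    change _ = (T q (zs q) ((Tz ^ i) (v k))) m
    rw [Tz_pow_v, T_zs, Tzs_v, Finsupp.smul_apply, v_apply]
    by_cases h : m + 1 = k + i
    · rw [if_pos h, if_pos (by omega), h, Complex.ofReal_mul, Complex.ofReal_inv,
        inv_mul_cancel_left₀ (sqrt_weight_ne_zero hq0 hq1 hα m k), smul_eq_mul, mul_one]
    · rw [if_neg h, mul_zero]
      -- Truncation makes m = k + i - 1 possible off the diagonal only for k + i = 0, where the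
      -- coefficient 1 - q^0 is zero.
      by_cases h' : m = k + i - 1
      · have : k + i = 0 := by omega
        simp [this]
      · rw [if_neg h', smul_zero]
  · rw [inner_zVec, zsHat, ofBasis_X_pow]
    simp only [hxa, add_assoc, add_right_inj]
    by_cases h : j + 1 = i
    · subst h
      simp only [if_true, Nat.add_sub_cancel, Nat.succ_ne_zero, if_false, coeff_C_mul_X_pow]
      rw [← Complex.ofReal_mul, div_mul_cancel₀ _ (zNormSq_pos hq0 hq1 hα j).ne',
        ← (hasSum_weight hq0 hq1 hα (j + 1)).tsum_eq, Complex.ofReal_tsum]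
      refine tsum_congr fun k => ?_
      rw [Complex.ofReal_mul, ← mul_assoc, sqrt_weight_mul_self hq0 hq1 hα, ← Complex.ofReal_mul,
        ← add_assoc k j 1, weight_succ_left]
    · simp only [h, if_false, mul_zero, tsum_zero]
      split_ifs with h0
      · simp
      · rw [coeff_C_mul_X_pow, if_neg (by omega), zero_mul]

/-- Composing the matrix unit with T(z)^i gives the matrix unit v_{b-i} ↦ v_a, or zero if i > b. It
is orthogonal to every z^j except possibly j = a + i - b. -/
lemma isToeplitzBergman_unitHat {q α : ℝ} (hq0 : 0 < q) (hq1 : q < 1) (hα : 0 < α) (a b : ℕ) :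
    IsToeplitzBergman q α (unitOp a b) (unitHat q α a b) := by
  refine isToeplitzBergman_of_basis hq0 hq1 hα fun i => ?_
  by_cases hi : i ≤ b
  · refine ⟨unitVec q α a (b - i), dist_ext fun k m => ?_, fun j => ?_⟩
    · rw [toDist_unitVec hq0 hq1 hα]
      change _ = (unitOp a b ((Tz ^ i) (v k))) m
      rw [Tz_pow_v, unitOp_v]
      by_cases h : k + i = b
      · rw [if_pos h, v_apply]
        simp [show k = b - i by omega]
      · simp [h, show k ≠ b - i by omega]
    · rw [inner_zVec_unitVec, unitHat, ofBasis_X_pow]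
      by_cases h : b ≤ a + i
      · rw [if_pos (c := i ≤ b ∧ b ≤ a + i) ⟨hi, h⟩, coeff_C_mul_X_pow]
        by_cases hj : j = a + i - b
        · rw [if_pos hj, if_pos (by omega), hj, ← Complex.ofReal_mul,
            div_mul_cancel₀ _ (zNormSq_pos hq0 hq1 hα _).ne']
        · rw [if_neg hj, if_neg (by omega), zero_mul]
      · rw [if_neg (by omega), if_neg (by omega), coeff_zero, zero_mul]
  · refine ⟨0, dist_ext fun k m => ?_, fun j => ?_⟩
    · rw [map_zero]
      change 0 = (unitOp a b ((Tz ^ i) (v k))) m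
      rw [Tz_pow_v, unitOp_v, if_neg (by omega), Finsupp.zero_apply]
    · rw [inner_zero_right, unitHat, ofBasis_X_pow, if_neg (by omega), coeff_zero, zero_mul]

/-! ### Covariant symbols in terms of matrix elements -/

lemma exists_dist (M : ℕ → ℕ → ℂ) : ∃ f : Dist, ∀ b a, f (v a) b = M b a :=
  ⟨Finsupp.linearCombination ℂ fun a b => M b a, fun b a => by simp [v]⟩

lemma exists_fbar (M : ℕ → ℕ → ℂ) : ∃ A : Fbar, ∀ b a, PowerSeries.coeff b (A (X ^ a)) = M b a :=
  ⟨ofBasis fun a => PowerSeries.mk fun b => M b a, fun b a => by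
    rw [ofBasis_X_pow, PowerSeries.coeff_mk]⟩

lemma fbar_ext {A B : Fbar}
    (h : ∀ b a, PowerSeries.coeff b (A (X ^ a)) = PowerSeries.coeff b (B (X ^ a))) : A = B := by
  refine Polynomial.lhom_ext' fun a => LinearMap.ext_ring ?_
  ext b
  simpa [X_pow_eq_monomial] using h b a

/-- The matrix elements `f_{ba}` of a distribution, divided by `‖v_a‖²`. -/
def distMatrix (q : ℝ) (f : Dist) (b a : ℕ) : ℂ := f (v a) b / (normSqV q a : ℂ)

/-- The matrix elements of an operator from `ℂ[z]` to `ℂ[[z]]`, divided by `‖z^a‖²`. -/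
def fbarMatrix (q α : ℝ) (A : Fbar) (b a : ℕ) : ℂ :=
  PowerSeries.coeff b (A (X ^ a)) / (zNormSq q α a : ℂ)

lemma oneSubPow_neg_one_v {q : ℝ} (hq0 : 0 < q) (k : ℕ) :
    oneSubPow q (-1) (v k) = (((q ^ (2 * k))⁻¹ : ℝ) : ℂ) • v k := by
  rw [oneSubPow_v, mul_neg_one, Real.rpow_neg hq0.le]
  congr 3
  exact_mod_cast Real.rpow_natCast q (2 * k)

lemma integral_eq {q : ℝ} (hq0 : 0 < q) (f : Dist) :
    integral q f = ((1 - q ^ 2 : ℝ) : ℂ) *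
      ∑ᶠ k : ℕ, (((q ^ (2 * k))⁻¹ : ℝ) : ℂ) * f (v k) k := by
  rw [integral]
  congr 1
  refine finsum_congr fun k => ?_
  rw [oneSubPow_neg_one_v hq0, map_smul]
  rfl

/-! ### Linearity of the integral and of the q-trace, and their values on matrix units -/

section

variable {q α : ℝ}

lemma integral_add (hq0 : 0 < q) {f g : Dist} {n n' : ℕ} (hf : ∀ k, n ≤ k → f (v k) = 0)
    (hg : ∀ k, n' ≤ k → g (v k) = 0) : integral q (f + g) = integral q f + integral q g := by
  rw [integral_eq hq0, integral_eq hq0, integral_eq hq0, ← mul_add, ← finsum_add_distrib]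
  · simp only [LinearMap.add_apply, Pi.add_apply, mul_add]
  · refine (Set.finite_Iio n).subset fun k hk => ?_
    by_contra hc
    exact hk (by beta_reduce; rw [hf k (not_lt.mp hc), Pi.zero_apply, mul_zero])
  · refine (Set.finite_Iio n').subset fun k hk => ?_
    by_contra hc
    exact hk (by beta_reduce; rw [hg k (not_lt.mp hc), Pi.zero_apply, mul_zero])

lemma integral_smul (hq0 : 0 < q) (f : Dist) (c : ℂ) :
    integral q (c • f) = c * integral q f := by
  rw [integral_eq hq0, integral_eq hq0, mul_left_comm, ← smul_eq_mul c (∑ᶠ _, _), smul_finsum]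
  simp only [LinearMap.smul_apply, Pi.smul_apply, smul_eq_mul, mul_left_comm]

lemma trq_add {A B : Fbar} {n n' : ℕ} (hA : ∀ k, n ≤ k → A (X ^ k) = 0)
    (hB : ∀ k, n' ≤ k → B (X ^ k) = 0) : trq q (A + B) = trq q A + trq q B := by
  rw [trq, trq, trq, ← finsum_add_distrib]
  · simp only [LinearMap.add_apply, map_add, add_mul]
  · refine (Set.finite_Iio n).subset fun k hk => ?_
    by_contra hc
    exact hk (by beta_reduce; rw [hA k (not_lt.mp hc), map_zero, zero_mul])
  · refine (Set.finite_Iio n').subset fun k hk => ?_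
    by_contra hc
    exact hk (by beta_reduce; rw [hB k (not_lt.mp hc), map_zero, zero_mul])

lemma trq_smul (A : Fbar) (c : ℂ) : trq q (c • A) = c * trq q A := by
  rw [trq, trq, ← smul_eq_mul c (∑ᶠ _, _), smul_finsum]
  simp only [LinearMap.smul_apply, map_smul, smul_eq_mul, mul_assoc]

lemma integral_comp_unitOp (hq0 : 0 < q) (f : Dist) (a b : ℕ) :
    integral q (f ∘ₗ unitOp a b)
      = ((1 - q ^ 2 : ℝ) : ℂ) * ((((q ^ (2 * b))⁻¹ : ℝ) : ℂ) * f (v a) b) := by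
  rw [integral_eq hq0, finsum_eq_single _ b]
  · rw [LinearMap.comp_apply, unitOp_v, if_pos rfl]
  · intro k hk
    rw [LinearMap.comp_apply, unitOp_v, if_neg hk, map_zero, Pi.zero_apply, mul_zero]

lemma unitHat_X_pow_eq_zero (a : ℕ) {b i : ℕ} (h : b < i) : unitHat q α a b (X ^ i) = 0 := by
  rw [unitHat, ofBasis_X_pow, if_neg (by omega)]

/-- The source of `symbolSeries`: its coefficients collect the factors of the weight and of q^{-2k}
that depend on the step s along the diagonal. -/
lemma trq_comp_unitHat (hq0 : 0 < q) (hq1 : q < 1) (hα : 0 < α) (A : Fbar) (a b : ℕ) :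
    (((1 - q ^ 2) / (1 - q ^ (4 * α)) : ℝ) : ℂ) * trq q (A ∘ₗ unitHat q α a b)
      = ((1 - q ^ 2 : ℝ) : ℂ) * ((((q ^ (2 * b))⁻¹ : ℝ) : ℂ) *
        ((normSqV q a : ℂ) * diagConv (symbolSeries q α) (fbarMatrix q α A) b a)) := by
  have ht : 1 - q ^ (4 * α) ≠ 0 := (sub_pos.mpr (rpow_mem hq0 hq1 hα).2).ne'
  -- The trace runs over i ≤ b; reflection puts i = b - s, and the terms with s > a vanish.
  rw [trq, finsum_eq_sum_of_support_subset (s := Finset.range (b + 1)),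
    ← Finset.sum_range_reflect, diagConv,
    ← Finset.sum_subset (Finset.range_mono (Nat.succ_le_succ (min_le_left b a))),
    Finset.mul_sum, Finset.mul_sum, Finset.mul_sum, Finset.mul_sum]
  · refine Finset.sum_congr rfl fun s hs => ?_
    have hsb : s ≤ b := by have := Finset.mem_range.mp hs; omega
    have hsa : s ≤ a := by have := Finset.mem_range.mp hs; omega
    have hw : weight q α a s * (q ^ (2 * (b - s)))⁻¹ = (1 - q ^ (4 * α)) * (normSqV q a *
        (q ^ (2 * b))⁻¹ * ((q ^ (4 * α) * q ^ 2) ^ s / normSqV q s)) := by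
      have hb : q ^ (2 * b) = q ^ (2 * (b - s)) * (q ^ 2) ^ s := by
        rw [← pow_mul, ← pow_add]
        congr 1
        omega
      have := (normSqV_pos hq0 hq1 s).ne'
      rw [weight_eq hq0, hb, mul_pow]
      field_simp
    have hw' := congrArg (fun r : ℝ => (r : ℂ)) hw
    have ht' : ((1 - q ^ (4 * α) : ℝ) : ℂ) ≠ 0 := Complex.ofReal_ne_zero.mpr ht
    rw [show b + 1 - 1 - s = b - s by omega, LinearMap.comp_apply, unitHat, ofBasis_X_pow,
      if_pos (by omega), ← smul_eq_C_mul, map_smul, map_smul, smul_eq_mul,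
      show b - (b - s) = s by omega, show a + (b - s) - b = a - s by omega, symbolSeries,
      PowerSeries.coeff_mk, fbarMatrix]
    simp only [Complex.ofReal_mul] at hw'
    rw [Complex.ofReal_div (1 - q ^ 2), Complex.ofReal_div (weight q α a s)]
    rw [div_mul_eq_mul_div, div_eq_iff ht']
    linear_combination (((1 - q ^ 2 : ℝ) : ℂ) * PowerSeries.coeff (b - s) (A (X ^ (a - s))) /
      (zNormSq q α (a - s) : ℂ)) * hw'
  · intro s hs hs'
    rw [Finset.mem_range] at hs hs'
    rw [LinearMap.comp_apply, unitHat, ofBasis_X_pow, if_neg (by omega), map_zero, map_zero,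
      zero_mul]
  · intro i hi
    by_contra hc
    refine hi ?_
    beta_reduce
    rw [LinearMap.comp_apply, unitHat_X_pow_eq_zero, map_zero, map_zero, zero_mul]
    simpa using hc

/-- The relation between the covariant symbol and the operator for a single symbol `ψ`, with the
finiteness that makes it additive in `ψ`. -/
def SymbolRelation (q α : ℝ) (A : Fbar) (f : Dist) (ψ : Module.End ℂ H) : Prop :=
  (∃ n, ∀ k, n ≤ k → ψ (v k) = 0) ∧
  ∃ Ψ : Module.End ℂ ℂ[X], IsToeplitzBergman q α ψ Ψ ∧ (∃ n, ∀ k, n ≤ k → Ψ (X ^ k) = 0) ∧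
    integral q (f ∘ₗ ψ) = (((1 - q ^ 2) / (1 - q ^ (4 * α)) : ℝ) : ℂ) * trq q (A ∘ₗ Ψ)

lemma SymbolRelation.add (hq0 : 0 < q) {A : Fbar} {f : Dist} {ψ φ : Module.End ℂ H}
    (h : SymbolRelation q α A f ψ) (h' : SymbolRelation q α A f φ) :
    SymbolRelation q α A f (ψ + φ) := by
  obtain ⟨⟨n, hn⟩, Ψ, hΨ, ⟨m, hm⟩, e⟩ := h
  obtain ⟨⟨n', hn'⟩, Φ, hΦ, ⟨m', hm'⟩, e'⟩ := h'
  refine ⟨⟨max n n', fun k hk => ?_⟩, Ψ + Φ, hΨ.add hΦ, ⟨max m m', fun k hk => ?_⟩, ?_⟩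
  · rw [LinearMap.add_apply, hn k (by omega), hn' k (by omega), add_zero]
  · rw [LinearMap.add_apply, hm k (by omega), hm' k (by omega), add_zero]
  · rw [LinearMap.comp_add, LinearMap.comp_add, integral_add hq0 (n := n) (n' := n'),
      trq_add (n := m) (n' := m'), e, e', mul_add]
    · exact fun k hk => by rw [LinearMap.comp_apply, hm k hk, map_zero]
    · exact fun k hk => by rw [LinearMap.comp_apply, hm' k hk, map_zero]
    · exact fun k hk => by rw [LinearMap.comp_apply, hn k hk, map_zero]
    · exact fun k hk => by rw [LinearMap.comp_apply, hn' k hk, map_zero]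

lemma SymbolRelation.smul (hq0 : 0 < q) {A : Fbar} {f : Dist} {ψ : Module.End ℂ H}
    (h : SymbolRelation q α A f ψ) (c : ℂ) : SymbolRelation q α A f (c • ψ) := by
  obtain ⟨⟨n, hn⟩, Ψ, hΨ, ⟨m, hm⟩, e⟩ := h
  refine ⟨⟨n, fun k hk => ?_⟩, c • Ψ, hΨ.smul c, ⟨m, fun k hk => ?_⟩, ?_⟩
  · rw [LinearMap.smul_apply, hn k hk, smul_zero]
  · rw [LinearMap.smul_apply, hm k hk, smul_zero]
  · rw [LinearMap.comp_smul, LinearMap.comp_smul, integral_smul hq0, trq_smul, e, mul_left_comm]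

lemma SymbolRelation.zero (A : Fbar) (f : Dist) : SymbolRelation q α A f 0 :=
  ⟨⟨0, fun _ _ => rfl⟩, 0, IsToeplitzBergman.zero, ⟨0, fun _ _ => rfl⟩, by
    simp [integral, trq]⟩

lemma eq_sum_unitOp {ψ : Module.End ℂ H} (hψ : IsFiniteFunction ψ) :
    ψ = ∑ p ∈ hψ.toFinset, ψ (v p.2) p.1 • unitOp p.1 p.2 := by
  classical
  refine Finsupp.lhom_ext' fun k => LinearMap.ext_ring ?_
  change ψ (v k) = (∑ p ∈ hψ.toFinset, ψ (v p.2) p.1 • unitOp p.1 p.2) (v k)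
  ext m
  simp only [LinearMap.sum_apply, LinearMap.smul_apply, unitOp_v, Finsupp.finsetSum_apply,
    Finsupp.smul_apply, smul_eq_mul]
  rw [Finset.sum_eq_single (m, k)]
  · simp [v_apply]
  · rintro ⟨a, b⟩ _ hp
    by_cases hb : k = b
    · have ha : m ≠ a := by rintro rfl; exact hp (by rw [hb])
      simp [hb, v_apply, ha]
    · simp [hb]
  · intro h
    have : ψ (v k) m = 0 := by
      by_contra hc
      exact h ((Set.Finite.mem_toFinset hψ).mpr hc)
    simp [this]

lemma isFiniteFunction_unitOp (a b : ℕ) : IsFiniteFunction (unitOp a b) := by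
  refine (Set.finite_singleton (a, b)).subset ?_
  rintro ⟨m, k⟩ h
  simp only [Set.mem_ofPred_eq, unitOp_v] at h
  by_cases hk : k = b
  · rw [if_pos hk, v_apply] at h
    simp_all
  · simp [hk] at h

/-- The identity is linear in ψ, so matrix units suffice; on them the common factors (1 - q²)
q^{-2b} cancel. -/
lemma isCovariantSymbol_iff (hq0 : 0 < q) (hq1 : q < 1) (hα : 0 < α) (A : Fbar) (f : Dist) :
    IsCovariantSymbol q α A f ↔
      distMatrix q f = diagConv (symbolSeries q α) (fbarMatrix q α A) := by
  have key (a b : ℕ) : integral q (f ∘ₗ unitOp a b) =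
      (((1 - q ^ 2) / (1 - q ^ (4 * α)) : ℝ) : ℂ) * trq q (A ∘ₗ unitHat q α a b) ↔
      distMatrix q f b a = diagConv (symbolSeries q α) (fbarMatrix q α A) b a := by
    have h1 : ((1 - q ^ 2 : ℝ) : ℂ) ≠ 0 :=
      Complex.ofReal_ne_zero.mpr (sub_pos.mpr (pow_lt_one₀ hq0.le hq1 two_ne_zero)).ne'
    have h2 : (((q ^ (2 * b))⁻¹ : ℝ) : ℂ) ≠ 0 :=
      Complex.ofReal_ne_zero.mpr (inv_pos.mpr (pow_pos hq0 _)).ne'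
    have h3 := Complex.ofReal_ne_zero.mpr (normSqV_pos hq0 hq1 a).ne'
    rw [integral_comp_unitOp hq0, trq_comp_unitHat hq0 hq1 hα, mul_right_inj' h1,
      mul_right_inj' h2, distMatrix, div_eq_iff h3, mul_comm (normSqV q a : ℂ)]
  constructor
  · intro h
    ext b a
    obtain ⟨Ψ, hΨ, e⟩ := h (unitOp a b) (isFiniteFunction_unitOp a b)
    -- The operator supplied by the definition is only existential; uniqueness identifies it with
    -- the explicit one.
    obtain rfl := hΨ.unique hq0 hq1 hα (isToeplitzBergman_unitHat hq0 hq1 hα a b)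
    exact (key a b).mp e
  · intro h ψ hψ
    have hS : SymbolRelation q α A f ψ := by
      rw [eq_sum_unitOp hψ]
      refine Finset.sum_induction _ (SymbolRelation q α A f) (fun _ _ => SymbolRelation.add hq0)
        (SymbolRelation.zero A f) fun p _ => SymbolRelation.smul hq0 ?_ _
      refine ⟨⟨p.2 + 1, fun k hk => ?_⟩, unitHat q α p.1 p.2,
        isToeplitzBergman_unitHat hq0 hq1 hα _ _, ⟨p.2 + 1, fun k hk => ?_⟩,
        (key _ _).mpr (by rw [h])⟩
      · rw [unitOp_v, if_neg (by omega)]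
      · exact unitHat_X_pow_eq_zero _ hk
    obtain ⟨-, Ψ, hΨ, -, e⟩ := hS
    exact ⟨Ψ, hΨ, e⟩

/-! ### Bijectivity of the symbol map -/

lemma distMatrix_injective (hq0 : 0 < q) (hq1 : q < 1) : Function.Injective (distMatrix q) := by
  intro f g h
  refine dist_ext fun a b => ?_
  have h3 := Complex.ofReal_ne_zero.mpr (normSqV_pos hq0 hq1 a).ne'
  exact (div_left_inj' h3).mp (congrFun (congrFun h b) a)

lemma distMatrix_surjective (hq0 : 0 < q) (hq1 : q < 1) : Function.Surjective (distMatrix q) := by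
  intro M
  obtain ⟨f, hf⟩ := exists_dist fun b a => M b a * (normSqV q a : ℂ)
  refine ⟨f, ?_⟩
  ext b a
  rw [distMatrix, hf, mul_div_cancel_right₀ _
    (Complex.ofReal_ne_zero.mpr (normSqV_pos hq0 hq1 a).ne')]

lemma fbarMatrix_injective (hq0 : 0 < q) (hq1 : q < 1) (hα : 0 < α) :
    Function.Injective (fbarMatrix q α) := by
  intro A B h
  refine fbar_ext fun b a => ?_
  have h3 := Complex.ofReal_ne_zero.mpr (zNormSq_pos hq0 hq1 hα a).ne'
  exact (div_left_inj' h3).mp (congrFun (congrFun h b) a)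

lemma fbarMatrix_surjective (hq0 : 0 < q) (hq1 : q < 1) (hα : 0 < α) :
    Function.Surjective (fbarMatrix q α) := by
  intro M
  obtain ⟨A, hA⟩ := exists_fbar fun b a => M b a * (zNormSq q α a : ℂ)
  refine ⟨A, ?_⟩
  ext b a
  rw [fbarMatrix, hA, mul_div_cancel_right₀ _
    (Complex.ofReal_ne_zero.mpr (zNormSq_pos hq0 hq1 hα a).ne')]

lemma existsUnique_covariantSymbol (hq0 : 0 < q) (hq1 : q < 1) (hα : 0 < α) (A : Fbar) :
    ∃! f : Dist, IsCovariantSymbol q α A f := by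
  simp only [isCovariantSymbol_iff hq0 hq1 hα]
  exact Function.Bijective.existsUnique
    ⟨distMatrix_injective hq0 hq1, distMatrix_surjective hq0 hq1⟩ _

lemma existsUnique_operator (hq0 : 0 < q) (hq1 : q < 1) (hα : 0 < α) (f : Dist) :
    ∃! A : Fbar, IsCovariantSymbol q α A f := by
  have hs := constantCoeff_symbolSeries q α
  simp only [isCovariantSymbol_iff hq0 hq1 hα]
  have hiff (A : Fbar) : distMatrix q f = diagConv (symbolSeries q α) (fbarMatrix q α A) ↔
      fbarMatrix q α A = diagConv (symbolSeries q α)⁻¹ (distMatrix q f) := by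
    constructor <;> intro h
    · rw [h, ← diagConv_mul, PowerSeries.inv_mul_cancel _ hs, diagConv_one]
    · rw [h, ← diagConv_mul, PowerSeries.mul_inv_cancel _ hs, diagConv_one]
  simp only [hiff]
  exact Function.Bijective.existsUnique
    ⟨fbarMatrix_injective hq0 hq1 hα, fbarMatrix_surjective hq0 hq1 hα⟩ _

/-! ### Convergence of the series -/

lemma hasSum_dist {ι : Type*} {F : ι → Dist} {f : Dist}
    (h : ∀ k m, HasSum (fun i => F i (v k) m) (f (v k) m)) : HasSum F f := by
  have hi : Topology.IsInducing (fun (f : Dist) (k m : ℕ) => f (v k) m) := ⟨rfl⟩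
  rw [HasSum, hi.tendsto_nhds_iff, tendsto_pi_nhds]
  intro k
  rw [tendsto_pi_nhds]
  intro m
  refine (h k m).congr fun s => ?_
  simp

lemma hasSum_fbar {ι : Type*} {F : ι → Fbar} {A : Fbar}
    (h : ∀ k m, HasSum (fun i => PowerSeries.coeff m (F i (X ^ k)))
      (PowerSeries.coeff m (A (X ^ k)))) : HasSum F A := by
  -- The topology tests every polynomial; by linearity monomials are enough.
  have hp (p : ℂ[X]) (m : ℕ) : HasSum (fun i => PowerSeries.coeff m (F i p))
      (PowerSeries.coeff m (A p)) := by
    induction p using Polynomial.induction_on' with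
    | add p r hp hr => simpa only [map_add] using hp.add hr
    | monomial k c =>
      rw [← C_mul_X_pow_eq_monomial, ← smul_eq_C_mul]
      simpa only [map_smul, smul_eq_mul] using (h k m).mul_left c
  have hi : Topology.IsInducing
      (fun (A : Fbar) (ψ : ℂ[X]) (m : ℕ) => PowerSeries.coeff m (A ψ)) := ⟨rfl⟩
  rw [HasSum, hi.tendsto_nhds_iff, tendsto_pi_nhds]
  intro p
  rw [tendsto_pi_nhds]
  intro m
  refine (hp p m).congr fun s => ?_
  simp

lemma zsHat_pow_X_pow (hq0 : 0 < q) (hq1 : q < 1) (hα : 0 < α) (k i : ℕ) :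
    (zsHat q α ^ k) (X ^ i) = if k ≤ i then
      ((zNormSq q α i / zNormSq q α (i - k) : ℝ) : ℂ) • X ^ (i - k) else 0 := by
  induction k with
  | zero => simp [(zNormSq_pos hq0 hq1 hα i).ne']
  | succ k ih =>
    rw [pow_succ', Module.End.mul_apply, ih]
    by_cases h : k + 1 ≤ i
    · have := (zNormSq_pos hq0 hq1 hα (i - k)).ne'
      rw [if_pos (by omega), if_pos h, map_smul, zsHat, ofBasis_X_pow, if_neg (by omega),
        ← smul_eq_C_mul, smul_smul, ← Complex.ofReal_mul, Nat.sub_sub, div_mul_div_cancel₀ this]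
    · rw [if_neg h]
      split_ifs with h'
      · rw [map_smul, zsHat, ofBasis_X_pow, if_pos (by omega), smul_zero]
      · exact map_zero _

lemma zHat_pow_apply (j : ℕ) (p : ℂ[X]) : (zHat ^ j) p = X ^ j * p := by
  rw [zHat, LinearMap.pow_mulLeft, LinearMap.mulLeft_apply]

lemma coeff_zHat_pow_mul_zsHat_pow (hq0 : 0 < q) (hq1 : q < 1) (hα : 0 < α) (j k i m : ℕ) :
    PowerSeries.coeff m (toFbar (zHat ^ j * zsHat q α ^ k) (X ^ i)) = (zNormSq q α i : ℂ) *
      if k ≤ i ∧ m + k = i + j then PowerSeries.coeff (i - k) (zNormSeries q α) else 0 := by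
  change PowerSeries.coeff m (((zHat ^ j * zsHat q α ^ k) (X ^ i) : ℂ[X]) : PowerSeries ℂ) = _
  rw [Polynomial.coeff_coe, Module.End.mul_apply, zsHat_pow_X_pow hq0 hq1 hα]
  by_cases h : k ≤ i
  · rw [if_pos h, map_smul, zHat_pow_apply, ← pow_add, coeff_smul, coeff_X_pow]
    by_cases hm : m = j + (i - k)
    · rw [if_pos hm, if_pos ⟨h, by omega⟩, zNormSeries, PowerSeries.coeff_mk,
        ← Complex.ofReal_mul, smul_eq_mul, mul_one, div_eq_mul_inv]
    · rw [if_neg hm, if_neg (by omega), smul_zero, mul_zero]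
  · rw [if_neg h, map_zero, coeff_zero, if_neg (by omega), mul_zero]

lemma Tzs_pow_v (hq0 : 0 < q) (hq1 : q < 1) (k i : ℕ) :
    (Tzs q ^ k) (v i) = if k ≤ i then
      ((normSqV q i / normSqV q (i - k) : ℝ) : ℂ) • v (i - k) else 0 := by
  induction k with
  | zero => simp [(normSqV_pos hq0 hq1 i).ne']
  | succ k ih =>
    rw [pow_succ', Module.End.mul_apply, ih]
    by_cases h : k + 1 ≤ i
    · obtain ⟨d, rfl⟩ := Nat.exists_eq_add_of_le h
      have h1 := (normSqV_pos hq0 hq1 d).ne'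
      have h2 := (one_sub_pow_pos hq0 hq1 d).ne'
      rw [if_pos (by omega), if_pos h, map_smul, Tzs_v, smul_smul, ← Complex.ofReal_mul,
        show k + 1 + d - k = d + 1 by omega, show k + 1 + d - (k + 1) = d by omega,
        Nat.add_sub_cancel, normSqV_succ q d]
      congr 2
      field_simp
    · rw [if_neg h]
      split_ifs with h'
      · rw [map_smul, Tzs_v, show i - k = 0 by omega]
        simp
      · exact map_zero _

lemma toDist_T_z_pow_mul_zs_pow (hq0 : 0 < q) (hq1 : q < 1) (j k i m : ℕ) :
    toDist (T q (z q ^ j * zs q ^ k)) (v i) m = (normSqV q i : ℂ) *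
      if k ≤ i ∧ m + k = i + j then PowerSeries.coeff (i - k) (vNormSeries q) else 0 := by
  rw [map_mul, map_pow, map_pow, T_z, T_zs]
  change (Tz ^ j) ((Tzs q ^ k) (v i)) m = _
  rw [Tzs_pow_v hq0 hq1]
  by_cases h : k ≤ i
  · rw [if_pos h, map_smul, Tz_pow_v, Finsupp.smul_apply, v_apply]
    by_cases hm : m = i - k + j
    · rw [if_pos hm, if_pos ⟨h, by omega⟩, vNormSeries, PowerSeries.coeff_mk,
        ← Complex.ofReal_mul, smul_eq_mul, mul_one, div_eq_mul_inv]
    · rw [if_neg hm, if_neg (by omega), smul_zero, mul_zero]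
  · rw [if_neg h, map_zero, Finsupp.zero_apply, if_neg (by omega), mul_zero]

/-- The two sums are prescribed by their normalized matrices, the convolutions of `a` with
`zNormSeries` and `vNormSeries`; the q-binomial identity then relates them. -/
lemma exists_hasSum_covariantSymbol (hq0 : 0 < q) (hq1 : q < 1) (hα : 0 < α) (a : ℕ → ℕ → ℂ) :
    ∃ (A : Fbar) (f : Dist),
      HasSum (fun p : ℕ × ℕ => a p.1 p.2 • toFbar (zHat ^ p.1 * zsHat q α ^ p.2)) A ∧
      HasSum (fun p : ℕ × ℕ => a p.1 p.2 • toDist (T q (z q ^ p.1 * zs q ^ p.2))) f ∧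
      IsCovariantSymbol q α A f := by
  obtain ⟨A, hA⟩ := fbarMatrix_surjective hq0 hq1 hα (diagConv (zNormSeries q α) a)
  obtain ⟨f, hf⟩ := distMatrix_surjective hq0 hq1 (diagConv (vNormSeries q) a)
  refine ⟨A, f, hasSum_fbar fun i m => ?_, hasSum_dist fun i m => ?_, ?_⟩
  · have hAi := congrFun (congrFun hA m) i
    rw [fbarMatrix, div_eq_iff
      (Complex.ofReal_ne_zero.mpr (zNormSq_pos hq0 hq1 hα i).ne'), mul_comm] at hAi
    rw [hAi]
    refine hasSum_of_eq (fun p => ?_) ((hasSum_diagConv _ a m i).mul_left _)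
    rw [LinearMap.smul_apply, map_smul, coeff_zHat_pow_mul_zsHat_pow hq0 hq1 hα, smul_eq_mul,
      mul_left_comm]
  · have hfi := congrFun (congrFun hf m) i
    rw [distMatrix, div_eq_iff
      (Complex.ofReal_ne_zero.mpr (normSqV_pos hq0 hq1 i).ne'), mul_comm] at hfi
    rw [hfi]
    refine hasSum_of_eq (fun p => ?_) ((hasSum_diagConv _ a m i).mul_left _)
    rw [LinearMap.smul_apply, Pi.smul_apply, toDist_T_z_pow_mul_zs_pow hq0 hq1, smul_eq_mul,
      mul_left_comm]
  · rw [isCovariantSymbol_iff hq0 hq1 hα, hA, hf, ← diagConv_mul,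
      symbolSeries_mul_zNormSeries hq0 hq1 hα]

end

end QDisc

end

theorem proposition6p6 (q α : ℝ) (hq0 : 0 < q) (hq1 : q < 1) (hα : 0 < α) :
    -- the Toeplitz-Bergman operators with symbols `z` and `z*`, as operators in `ℂ[z]`
    (∃ zhat zshat : Module.End ℂ (Polynomial ℂ),
      QDisc.IsToeplitzBergman q α (QDisc.T q (QDisc.z q)) zhat ∧
      QDisc.IsToeplitzBergman q α (QDisc.T q (QDisc.zs q)) zshat ∧
      -- both series converge, and the second sum is the covariant symbol of the first
      ∀ a : ℕ → ℕ → ℂ, ∃ (A : QDisc.Fbar) (f : QDisc.Dist),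
        HasSum (fun p : ℕ × ℕ => a p.1 p.2 • QDisc.toFbar (zhat ^ p.1 * zshat ^ p.2)) A ∧
        HasSum (fun p : ℕ × ℕ =>
          a p.1 p.2 • QDisc.toDist (QDisc.T q (QDisc.z q ^ p.1 * QDisc.zs q ^ p.2))) f ∧
        QDisc.IsCovariantSymbol q α A f) ∧
    -- every operator has exactly one covariant symbol
    (∀ A : QDisc.Fbar, ∃! f : QDisc.Dist, QDisc.IsCovariantSymbol q α A f) ∧
    -- every distribution is the covariant symbol of exactly one operator
    (∀ f : QDisc.Dist, ∃! A : QDisc.Fbar, QDisc.IsCovariantSymbol q α A f) := by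
  exact ⟨⟨QDisc.zHat, QDisc.zsHat q α, QDisc.isToeplitzBergman_zHat hq0 hq1 hα,
    QDisc.isToeplitzBergman_zsHat hq0 hq1 hα, QDisc.exists_hasSum_covariantSymbol hq0 hq1 hα⟩,
    QDisc.existsUnique_covariantSymbol hq0 hq1 hα, QDisc.existsUnique_operator hq0 hq1 hα⟩
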